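/- Let $d\ge 2$, let $\Omega\subset\mathbb{R}^d$ be a bounded open set with Lipschitz boundary, and let $\mu$ be a probability measure supported on $\overline\Omega$ with density $\rho$ with respect to Lebesgue measure on $\Omega$ (that is, $d\mu=\rho\,\mathbf 1_\Omega\,dx$), where $\rho$ is continuous on $\overline\Omega$ and $0<c\le\rho(x)\le C<\infty$ for all $x\in\overline\Omega$ and some constants $c,C$. Let $(\varepsilon_n)$ be a sequence of positive numbers with $\varepsilon_n\to0$ and $$\lim_{n\to\infty}\frac{(\log n)^{1/d}}{\varepsilon_n\,n^{1/d}}=0 .$$ Let $x_1,x_2,\dots$ be i.i.d. random points with law $\mu$, and let $\mu_n=\frac1n\sum_{i=1}^n\delta_{x_i}$ be the empirical measures. Then there exists a sequence of (random) probability measures $\tilde\mu_n$ on $\mathbb{R}^d$, each absolutely continuous with respect to $\mu$, such that (i) almost surely $d_\infty(\mu_n,\tilde\mu_n)\ll\varepsilon_n$, i.e. $d_\infty(\mu_n,\tilde\mu_n)/\varepsilon_n\to0$ as $n\to\infty$; (ii) almost surely $\dfrac{d\tilde\mu_n}{d\mu}\to1$ uniformly on $\overline\Omega$ as $n\to\infty$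 (for suitable versions of the densities, which are defined up to $\mu$-null sets). Here $d_\infty(\mu,\nu)=\inf_{\gamma}\operatorname{ess\,sup}_{(x,y)\sim\gamma}|x-y|$, the infimum being over all transport plans $\gamma$ between $\mu$ and $\nu$, i.e. measures on $\mathbb{R}^d\times\mathbb{R}^d$ with marginals $\mu$ and $\nu$. -/

import Mathlib

open MeasureTheory Filter Topology
open scoped ENNReal NNReal

noncomputable section

/-- `Ω` has Lipschitz boundary: near every boundary point there is a unit direction `e` such that,
in the orthogonal splitting of space into the hyperplane `eᗮ` and the line spanned by `e`, the set
`Ω` is the strict epigraph of a Lipschitz function defined on `eᗮ`. -/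
def HasLipschitzBoundary {d : ℕ} (Ω : Set (EuclideanSpace ℝ (Fin d))) : Prop :=
  ∀ x ∈ frontier Ω, ∃ e : EuclideanSpace ℝ (Fin d), ‖e‖ = 1 ∧
    ∃ r : ℝ, 0 < r ∧ ∃ (K : ℝ≥0) (g : (Submodule.span ℝ {e})ᗮ → ℝ), LipschitzWith K g ∧
      ∀ y ∈ Metric.ball x r,
        (y ∈ Ω ↔ g ((Submodule.span ℝ {e})ᗮ.orthogonalProjectionOnto y) < inner ℝ e y)

/-- The transport plans (couplings) between `μ` and `ν`. -/
def transportPlans {E : Type*} [MeasurableSpace E] (μ ν : Measure E) : Set (Measure (E × E)) :=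
  {γ | γ.map Prod.fst = μ ∧ γ.map Prod.snd = ν}

/-- The `∞`-transportation distance
`d_∞(μ, ν) = inf_γ ess sup_{(x, y) ∼ γ} |x - y|`, with values in `[0, ∞]`
(it is `∞` if there is no transport plan). -/
def transportDistInfty {E : Type*} [MeasurableSpace E] [PseudoEMetricSpace E]
    (μ ν : Measure E) : ℝ≥0∞ :=
  ⨅ γ ∈ transportPlans μ ν, essSup (fun p : E × E => edist p.1 p.2) γ

/-- The empirical measure `(1/n) ∑_{i < n} δ_{x i}` of the first `n` points of a sequence. -/
def empiricalMeasure {E : Type*} [MeasurableSpace E] (x : ℕ → E) (n : ℕ) : Measure E :=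
  (n : ℝ≥0∞)⁻¹ • ∑ i ∈ Finset.range n, Measure.dirac (x i)

end

/-!
The measures `μ̃ₙ` are obtained by smearing the empirical measure over the cells of a partition at a
scale `ℓ n` strictly between the fluctuation scale `(log n / n) ^ (1 / d)` and `ε n`
(`exists_intermediate_scale`). Since `ε n` is asymptotically larger than the fluctuation scale, there
is room for such an `ℓ n`, and no optimal matching theorem is needed.

The cells are the Voronoi cells of a maximal `ℓ n`-separated subset of `Ω`. Their traces on `Ω` have
diameter at most `2 * ℓ n`. Each cell contains the ball of radius `ℓ n / 2` around its centre, and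
the Lipschitz boundary makes `Ω` satisfy an interior ball condition
(`HasLipschitzBoundary.hasInteriorBalls`), so with the lower bound on `ρ` every cell has `μ`-mass at
least `κ * ℓ n ^ d` (`HasInteriorBalls.exists_partition`).

Let `μ̃ₙ` be the average of the conditional laws of `μ` on the cells of the sample points
(`smearedMeasure`). Moving each sample point onto the conditional law of its cell displaces mass by
at most `2 * ℓ n ≪ ε n`, which is the first claim (`transportDistInfty_smearedMeasure_le`). The
density of `μ̃ₙ` at `y` is the empirical frequency of the cell of `y` divided by its mass. As
`n * ℓ n ^ d ≫ log n` and there are at most `1 / (κ * ℓ n ^ d)` cells, the multiplicative Chernoff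
bound, a union bound and the Borel–Cantelli lemma show that these ratios converge to `1` uniformly,
almost surely (`ae_tendstoUniformly_cellRatio`), which is the second claim.
-/

/-! ### Interior balls in Lipschitz domains -/

/-- The interior ball condition for the points of `s ∩ Ω`: at every small scale `r`, the part of
`Ω` within distance `r` of such a point contains a ball of radius comparable to `r`. -/
def HasInteriorBalls {E : Type*} [PseudoMetricSpace E] (Ω s : Set E) : Prop :=
  ∃ η r₀ : ℝ, 0 < η ∧ 0 < r₀ ∧ ∀ x ∈ s ∩ Ω, ∀ r, 0 < r → r ≤ r₀ →
    ∃ y, Metric.ball y (η * r) ⊆ Ω ∩ Metric.ball x r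

theorem HasInteriorBalls.union {E : Type*} [PseudoMetricSpace E] {Ω s t : Set E}
    (hs : HasInteriorBalls Ω s) (ht : HasInteriorBalls Ω t) : HasInteriorBalls Ω (s ∪ t) := by
  obtain ⟨η, r, hη, hr, h⟩ := hs
  obtain ⟨η', r', hη', hr', h'⟩ := ht
  refine ⟨min η η', min r r', lt_min hη hη', lt_min hr hr', fun x hx ρ hρ hρr => ?_⟩
  rcases hx.1 with hxs | hxt
  · obtain ⟨y, hy⟩ := h x ⟨hxs, hx.2⟩ ρ hρ (hρr.trans (min_le_left _ _))
    exact ⟨y, (Metric.ball_subset_ball (by gcongr; exact min_le_left _ _)).trans hy⟩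
  · obtain ⟨y, hy⟩ := h' x ⟨hxt, hx.2⟩ ρ hρ (hρr.trans (min_le_right _ _))
    exact ⟨y, (Metric.ball_subset_ball (by gcongr; exact min_le_right _ _)).trans hy⟩

/-- Near a boundary point the domain contains, with each of its points, a truncated cone of fixed
opening around the direction `e`, and this cone contains a ball of comparable size. -/
theorem hasInteriorBalls_of_epigraph {d : ℕ} {Ω : Set (EuclideanSpace ℝ (Fin d))}
    {x₀ e : EuclideanSpace ℝ (Fin d)} (he : ‖e‖ = 1) {R : ℝ} (hR : 0 < R) {K : ℝ≥0}
    {g : (Submodule.span ℝ {e})ᗮ → ℝ} (hg : LipschitzWith K g)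
    (hΩ : ∀ y ∈ Metric.ball x₀ R,
      (y ∈ Ω ↔ g ((Submodule.span ℝ {e})ᗮ.orthogonalProjectionOnto y) < inner ℝ e y)) :
    HasInteriorBalls Ω (Metric.ball x₀ (R / 2)) := by
  have hK : (0 : ℝ) < 1 + K := by positivity
  refine ⟨1 / (2 * (1 + K)), R / 2, by positivity, by positivity, ?_⟩
  rintro x ⟨hx, hxΩ⟩ r hr hrR
  refine ⟨x + (r / 2) • e, fun y hy => ?_⟩
  set v := y - (x + (r / 2) • e) with hv
  have hyv : y = x + (r / 2) • e + v := by simp [hv]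
  have hvn : ‖v‖ < 1 / (2 * (1 + K)) * r := by simpa [hv, dist_eq_norm] using hy
  have hvr : (1 + K) * ‖v‖ < r / 2 := by
    calc (1 + K) * ‖v‖ < (1 + K) * (1 / (2 * (1 + K)) * r) := by gcongr
      _ = r / 2 := by field_simp
  have hKv : 0 ≤ K * ‖v‖ := by positivity
  have hyx : dist y x < r := by
    have : y - x = (r / 2) • e + v := by rw [hyv]; abel
    rw [dist_eq_norm, this]
    calc ‖(r / 2) • e + v‖ ≤ r / 2 + ‖v‖ := by
          refine (norm_add_le _ _).trans ?_
          rw [norm_smul, he, Real.norm_of_nonneg (by positivity), mul_one]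
      _ < r := by linarith
  refine ⟨?_, hyx⟩
  have hxR : x ∈ Metric.ball x₀ R := Metric.ball_subset_ball (by linarith) hx
  have hyR : y ∈ Metric.ball x₀ R := by
    have := dist_triangle y x x₀
    simp only [Metric.mem_ball] at hx ⊢
    linarith
  rw [hΩ y hyR]
  rw [hΩ x hxR] at hxΩ
  set p := (Submodule.span ℝ {e})ᗮ.orthogonalProjectionOnto with hp
  have hpe : p e = 0 :=
    Submodule.orthogonalProjectionOnto_orthogonalComplement_singleton_eq_zero e
  have hpy : p y - p x = p v := by rw [hyv]; simp [hpe]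
  have h1 : g (p y) ≤ g (p x) + K * ‖v‖ := by
    have := hg.dist_le_mul (p y) (p x)
    rw [Real.dist_eq, dist_eq_norm, hpy] at this
    have h2 : ‖p v‖ ≤ ‖v‖ := (p.le_opNorm v).trans
      (mul_le_of_le_one_left (norm_nonneg _) (Submodule.orthogonalProjectionOnto_norm_le _))
    have h3 : K * ‖p v‖ ≤ K * ‖v‖ := by gcongr
    linarith [le_abs_self (g (p y) - g (p x))]
  have h4 : inner ℝ e y = inner ℝ e x + r / 2 + inner ℝ e v := by
    rw [hyv, inner_add_right, inner_add_right, inner_smul_right, real_inner_self_eq_norm_sq, he]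
    ring
  have h5 : -‖v‖ ≤ inner ℝ e v := by
    have := abs_real_inner_le_norm e v
    rw [he, one_mul] at this
    exact (abs_le.1 this).1
  linarith

theorem HasLipschitzBoundary.hasInteriorBalls {d : ℕ} {Ω : Set (EuclideanSpace ℝ (Fin d))}
    (hΩ : HasLipschitzBoundary Ω) (hopen : IsOpen Ω) (hbdd : Bornology.IsBounded Ω) :
    HasInteriorBalls Ω Ω := by
  have key : HasInteriorBalls Ω (closure Ω) := by
    refine hbdd.isCompact_closure.induction_on ⟨1, 1, one_pos, one_pos, by simp⟩ ?_
      (fun s t => HasInteriorBalls.union) ?_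
    · rintro s t hst ⟨η, r, hη, hr, h⟩
      exact ⟨η, r, hη, hr, fun x hx => h x ⟨hst hx.1, hx.2⟩⟩
    · intro x hx
      by_cases hxΩ : x ∈ Ω
      · obtain ⟨R, hR, hball⟩ := Metric.isOpen_iff.1 hopen x hxΩ
        refine ⟨Metric.ball x (R / 2), mem_nhdsWithin_of_mem_nhds
          (Metric.ball_mem_nhds _ (by positivity)), 1, R / 2, one_pos, by positivity, ?_⟩
        refine fun y hy r hr hrR => ⟨y, ?_⟩
        rw [one_mul]
        refine Set.subset_inter ((Metric.ball_subset_ball' ?_).trans hball) subset_rfl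
        have := Metric.mem_ball.1 hy.1
        linarith
      · obtain ⟨e, he, R, hR, K, g, hg, h⟩ := hΩ x (by
          rw [hopen.frontier_eq]; exact ⟨hx, hxΩ⟩)
        exact ⟨_, mem_nhdsWithin_of_mem_nhds (Metric.ball_mem_nhds x (by positivity : 0 < R / 2)),
          hasInteriorBalls_of_epigraph he hR hg h⟩
  obtain ⟨η, r, hη, hr, h⟩ := key
  exact ⟨η, r, hη, hr, fun x hx => h x ⟨subset_closure hx.1, hx.2⟩⟩

/-! ### Partitions into small cells of large mass -/

/-- A totally bounded set has, at each scale, a finite maximal separated subset. -/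
theorem exists_finite_isSeparated_isCover {E : Type*} [PseudoEMetricSpace E] {Ω : Set E}
    (hΩ : TotallyBounded Ω) {ℓ : ℝ≥0} (hℓ : ℓ ≠ 0) :
    ∃ C ⊆ Ω, C.Finite ∧ Metric.IsSeparated ℓ C ∧ Metric.IsCover ℓ Ω C := by
  have hfin : Metric.packingNumber ℓ Ω ≠ ⊤ := by
    obtain ⟨N, -, hN, hcov⟩ := Metric.exists_finite_isCover_of_totallyBounded
      (ε := ℓ / 2) (by simpa using hℓ) hΩ
    have h := Metric.packingNumber_two_mul_le_externalCoveringNumber (ℓ / 2) Ω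
    rw [mul_div_cancel₀ _ two_ne_zero] at h
    exact ne_top_of_le_ne_top hN.encard_lt_top.ne (h.trans hcov.externalCoveringNumber_le_encard)
  refine ⟨Metric.maximalSeparatedSet ℓ Ω, Metric.maximalSeparatedSet_subset, ?_,
    Metric.isSeparated_maximalSeparatedSet, Metric.isCover_maximalSeparatedSet hfin⟩
  rw [← Set.encard_ne_top_iff, Metric.encard_maximalSeparatedSet hfin]
  exact hfin

/-- The Voronoi cells of a maximal `ℓ`-separated subset of `Ω`, encoded as the fibres of a simple
function: their traces on `Ω` have diameter at most `2 * ℓ`, and each cell contains the ball of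
radius `ℓ / 2` around its centre. -/
theorem exists_simpleFunc_voronoi {E : Type*} [MetricSpace E] [MeasurableSpace E]
    [OpensMeasurableSpace E] {Ω : Set E} (hΩ : TotallyBounded Ω) (hne : Ω.Nonempty)
    {ℓ : ℝ} (hℓ : 0 < ℓ) :
    ∃ T : SimpleFunc E E, (∀ x ∈ Ω, ∀ y ∈ Ω, T x = T y → dist x y ≤ 2 * ℓ) ∧
      ∀ x, T x ∈ Ω ∧ Metric.ball (T x) (ℓ / 2) ⊆ T ⁻¹' {T x} := by
  lift ℓ to ℝ≥0 using hℓ.le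
  obtain ⟨C, hCΩ, hCfin, hsep, hcov⟩ := exists_finite_isSeparated_isCover hΩ
    (ℓ := ℓ) (by rintro rfl; simp at hℓ)
  have hCne : C.Nonempty := by
    obtain ⟨x, hx⟩ := hne
    obtain ⟨c, hc, -⟩ := hcov hx
    exact ⟨c, hc⟩
  obtain ⟨e, rfl⟩ := hCfin.countable.exists_eq_range hCne
  obtain ⟨N, hN⟩ : ∃ N, ∀ j, ∃ k ≤ N, e k = e j := by
    choose! f hf using fun c : E => fun hc : c ∈ Set.range e => hc
    obtain ⟨N, hN⟩ := (hCfin.image f).bddAbove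
    exact ⟨N, fun j => ⟨f (e j), hN ⟨_, ⟨j, rfl⟩, rfl⟩, hf _ ⟨j, rfl⟩⟩⟩
  have hle : ∀ x j, edist (SimpleFunc.nearestPt e N x) x ≤ edist (e j) x := fun x j => by
    obtain ⟨k, hk, hkj⟩ := hN j
    exact hkj ▸ SimpleFunc.edist_nearestPt_le e x hk
  have hmem : ∀ x, SimpleFunc.nearestPt e N x ∈ Set.range e := fun x =>
    ⟨SimpleFunc.nearestPtInd e N x, rfl⟩
  refine ⟨SimpleFunc.nearestPt e N, ?_, fun x => ⟨hCΩ (hmem x), fun y hy => ?_⟩⟩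
  · have hclose : ∀ x ∈ Ω, dist (SimpleFunc.nearestPt e N x) x ≤ ℓ := fun x hx => by
      obtain ⟨-, ⟨j, rfl⟩, hj⟩ := hcov hx
      have hj' : edist x (e j) ≤ ℓ := hj
      rw [edist_comm] at hj'
      have := (hle x j).trans hj'
      rw [edist_nndist] at this
      exact_mod_cast this
    intro x hx y hy hxy
    have h1 := hclose x hx
    have h2 := hclose y hy
    rw [← hxy] at h2
    have := dist_triangle_left x y (SimpleFunc.nearestPt e N x)
    linarith
  · obtain ⟨j, hj⟩ := hmem x
    by_contra hne
    have h1 := hsep (hmem y) (hmem x) hne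
    have h2 := hle y j
    rw [hj] at h2
    have h4 : edist (SimpleFunc.nearestPt e N y) (SimpleFunc.nearestPt e N x) < ℓ := by
      rw [edist_dist, ENNReal.ofReal_lt_coe_iff (by positivity)]
      rw [edist_dist, edist_dist, ENNReal.ofReal_le_ofReal_iff dist_nonneg] at h2
      rw [Metric.mem_ball, dist_comm] at hy
      have := dist_triangle_right (SimpleFunc.nearestPt e N y) (SimpleFunc.nearestPt e N x) y
      linarith
    exact absurd h1 h4.not_gt

theorem ofReal_mul_le_withDensity_apply {α : Type*} [MeasurableSpace α] {ν : Measure α}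
    {Ω A : Set α} {ρ : α → ℝ} {c : ℝ} (hρ : ∀ x ∈ Ω, c ≤ ρ x) (hA : MeasurableSet A)
    (hAΩ : A ⊆ Ω) :
    ENNReal.ofReal c * ν A ≤ (ν.restrict Ω).withDensity (fun x => ENNReal.ofReal (ρ x)) A := by
  rw [withDensity_apply _ hA, Measure.restrict_restrict hA, Set.inter_eq_left.2 hAΩ,
    ← setLIntegral_const]
  exact setLIntegral_mono' hA fun x hx => ENNReal.ofReal_le_ofReal (hρ x (hAΩ hx))

/-- A bounded open set with the interior ball condition can be cut, at each small scale `ℓ`, into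
cells of diameter at most `2 * ℓ` and mass at least a constant times `ℓ ^ d`. -/
theorem HasInteriorBalls.exists_partition {d : ℕ} {Ω : Set (EuclideanSpace ℝ (Fin d))}
    (hΩ : HasInteriorBalls Ω Ω) (hbdd : Bornology.IsBounded Ω)
    (hne : Ω.Nonempty) {ρ : EuclideanSpace ℝ (Fin d) → ℝ} {c : ℝ} (hc : 0 < c)
    (hρ : ∀ x ∈ Ω, c ≤ ρ x) {μ : Measure (EuclideanSpace ℝ (Fin d))} [IsFiniteMeasure μ]
    (hμ : μ = (volume.restrict Ω).withDensity (fun x => ENNReal.ofReal (ρ x))) :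
    ∃ κ r₀ : ℝ, 0 < κ ∧ 0 < r₀ ∧ ∀ ℓ, 0 < ℓ → ℓ ≤ r₀ →
      ∃ T : SimpleFunc (EuclideanSpace ℝ (Fin d)) (EuclideanSpace ℝ (Fin d)),
        (∀ x ∈ Ω, ∀ y ∈ Ω, T x = T y → dist x y ≤ 2 * ℓ) ∧
        ∀ x, κ * ℓ ^ d ≤ μ.real (T ⁻¹' {T x}) := by
  obtain ⟨η, r₀, hη, hr₀, hball⟩ := hΩ
  set ω := (volume : Measure (EuclideanSpace ℝ (Fin d))).real (Metric.ball 0 1) with hω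
  have hωpos : 0 < ω :=
    ENNReal.toReal_pos (Metric.measure_ball_pos _ _ one_pos).ne' measure_ball_lt_top.ne
  refine ⟨c * ((η / 2) ^ d * ω), r₀, by positivity, hr₀, fun ℓ hℓ hℓr => ?_⟩
  obtain ⟨T, hT, hTball⟩ := exists_simpleFunc_voronoi
    (hbdd.isCompact_closure.totallyBounded.subset subset_closure) hne hℓ
  refine ⟨T, hT, fun x => ?_⟩
  obtain ⟨hxΩ, hsub⟩ := hTball x
  obtain ⟨y, hy⟩ := hball (T x) ⟨hxΩ, hxΩ⟩ (ℓ / 2) (by positivity) (by linarith)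
  have hvol : volume (Metric.ball y (η * (ℓ / 2))) =
      ENNReal.ofReal ((η * (ℓ / 2)) ^ d * ω) := by
    rw [Measure.addHaar_ball_of_pos _ _ (by positivity), finrank_euclideanSpace_fin,
      ENNReal.ofReal_mul (by positivity), hω, ofReal_measureReal measure_ball_lt_top.ne]
  have h := ofReal_mul_le_withDensity_apply (ν := volume) hρ measurableSet_ball
    (fun z hz => (hy hz).1)
  rw [← hμ, hvol, ← ENNReal.ofReal_mul hc.le] at h
  have h' := (ENNReal.ofReal_le_iff_le_toReal (measure_ne_top _ _)).1 h
  calc c * ((η / 2) ^ d * ω) * ℓ ^ d = c * ((η * (ℓ / 2)) ^ d * ω) := by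
        rw [mul_div_assoc', mul_comm η ℓ, mul_div_assoc, mul_pow]; ring
    _ ≤ μ.real (Metric.ball y (η * (ℓ / 2))) := h'
    _ ≤ _ := measureReal_mono fun z hz => hsub (hy hz).2

/-! ### Concentration of cell frequencies -/

theorem mgf_indicator_le {S E : Type*} [MeasurableSpace S] [MeasurableSpace E] {P : Measure S}
    {μ : Measure E} [IsProbabilityMeasure μ] {Y : S → E}
    (hY : Measurable Y) (hlaw : P.map Y = μ) {A : Set E} (hA : MeasurableSet A) (t : ℝ) :
    ProbabilityTheory.mgf (fun s => A.indicator (fun _ => (1 : ℝ)) (Y s)) P t ≤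
      Real.exp (μ.real A * (Real.exp t - 1)) := by
  have h1 : ∀ x, Real.exp (t * A.indicator (fun _ => (1 : ℝ)) x) =
      1 + A.indicator (fun _ => Real.exp t - 1) x := fun x => by
    by_cases hx : x ∈ A <;> simp [hx]
  have hmeas : Measurable fun x => Real.exp (t * A.indicator (fun _ => (1 : ℝ)) x) :=
    ((measurable_const.indicator hA).const_mul t).exp
  have h2 : ProbabilityTheory.mgf (fun s => A.indicator (fun _ => (1 : ℝ)) (Y s)) P t =
      1 + μ.real A * (Real.exp t - 1) := by
    rw [ProbabilityTheory.mgf]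
    rw [← integral_map (μ := P) (φ := Y)
      (f := fun x => Real.exp (t * A.indicator (fun _ => (1 : ℝ)) x)) hY.aemeasurable
      hmeas.aestronglyMeasurable, hlaw]
    simp_rw [h1]
    rw [integral_add (integrable_const _) ((integrable_const _).indicator hA),
      integral_indicator hA]
    simp
  rw [h2, add_comm]
  exact Real.add_one_le_exp _

/-- The multiplicative Chernoff bound for a binomial variable. The exponent is linear in the success
probability, which Hoeffding's inequality does not give. -/
theorem measureReal_abs_sum_indicator_sub_ge_le {S E : Type*} [MeasurableSpace S]
    [MeasurableSpace E] {P : Measure S} [IsProbabilityMeasure P] {μ : Measure E}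
    [IsProbabilityMeasure μ] {X : ℕ → S → E} (hX : ∀ i, Measurable (X i))
    (hindep : ProbabilityTheory.iIndepFun X P) (hlaw : ∀ i, P.map (X i) = μ)
    {A : Set E} (hA : MeasurableSet A) {δ : ℝ} (hδ : 0 < δ) (hδ1 : δ ≤ 1) (n : ℕ) :
    P.real {s | δ * (n * μ.real A) ≤
      |∑ i ∈ Finset.range n, A.indicator (fun _ => (1 : ℝ)) (X i s) - n * μ.real A|} ≤
      2 * Real.exp (-(n * μ.real A * δ ^ 2 / 4)) := by
  set p := μ.real A
  have hp : 0 ≤ p := measureReal_nonneg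
  set Y : ℕ → S → ℝ := fun i s => A.indicator (fun _ => (1 : ℝ)) (X i s) with hYdef
  have hind : Measurable (A.indicator (fun _ => (1 : ℝ))) := measurable_const.indicator hA
  have hY : ∀ i, Measurable (Y i) := fun i => hind.comp (hX i)
  have hYindep : ProbabilityTheory.iIndepFun Y P := hindep.comp _ fun _ => hind
  have hmgf : ∀ t, ProbabilityTheory.mgf (∑ i ∈ Finset.range n, Y i) P t ≤
      Real.exp (n * (p * (Real.exp t - 1))) := fun t => by
    rw [hYindep.mgf_sum hY, Real.exp_nat_mul]
    calc _ ≤ ∏ _i ∈ Finset.range n, Real.exp (p * (Real.exp t - 1)) :=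
          Finset.prod_le_prod (fun i _ => ProbabilityTheory.mgf_nonneg)
            fun i _ => mgf_indicator_le (hX i) (hlaw i) hA t
      _ = _ := by simp
  have hint : ∀ t, Integrable (fun s => Real.exp (t * (∑ i ∈ Finset.range n, Y i) s)) P :=
    fun t => by
    refine Integrable.of_bound (C := Real.exp (|t| * n)) ?_ (ae_of_all _ fun s => ?_)
    · simp only [Finset.sum_apply]
      exact (((Finset.measurable_sum _ fun i _ => hY i).const_mul t).exp).aestronglyMeasurable
    · rw [Real.norm_of_nonneg (Real.exp_pos _).le]
      refine Real.exp_le_exp.2 ((le_abs_self _).trans ?_)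
      rw [abs_mul]
      gcongr
      rw [Finset.sum_apply]
      refine (Finset.abs_sum_le_sum_abs _ _).trans ?_
      refine (Finset.sum_le_card_nsmul _ _ 1 fun i _ => ?_).trans (by simp)
      by_cases h : X i s ∈ A <;> simp [hYdef, h]
  -- Both tails use `exp t - 1 ≤ t + t ^ 2`, at `t = δ / 2` and at `t = -δ / 2`.
  have hexp : ∀ t : ℝ, |t| ≤ 1 → Real.exp t - 1 ≤ t + t ^ 2 := fun t ht => by
    have := (abs_le.1 (Real.abs_exp_sub_one_sub_id_le ht)).2
    linarith
  have hup := (ProbabilityTheory.measure_ge_le_exp_mul_mgf (μ := P)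
    (X := ∑ i ∈ Finset.range n, Y i) ((1 + δ) * (n * p)) (half_pos hδ).le (hint _)).trans
      (mul_le_mul_of_nonneg_left (hmgf _) (Real.exp_pos _).le)
  have hlo := (ProbabilityTheory.measure_le_le_exp_mul_mgf (μ := P)
    (X := ∑ i ∈ Finset.range n, Y i) (t := -(δ / 2)) ((1 - δ) * (n * p)) (by linarith)
      (hint _)).trans (mul_le_mul_of_nonneg_left (hmgf _) (Real.exp_pos _).le)
  rw [← Real.exp_add] at hup hlo
  have hnp : 0 ≤ n * p := by positivity
  have e1 := mul_le_mul_of_nonneg_left (hexp (δ / 2) (by rw [abs_of_pos] <;> linarith)) hnp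
  have e2 := mul_le_mul_of_nonneg_left
    (hexp (-(δ / 2)) (by rw [abs_neg, abs_of_pos] <;> linarith)) hnp
  have hup' := hup.trans (Real.exp_le_exp.2
    (show _ ≤ -(n * p * δ ^ 2 / 4) by nlinarith))
  have hlo' := hlo.trans (Real.exp_le_exp.2
    (show _ ≤ -(n * p * δ ^ 2 / 4) by nlinarith))
  rw [two_mul]
  refine ((measureReal_mono ?_).trans (measureReal_union_le _ _)).trans (add_le_add hup' hlo')
  intro s hs
  simp only [Set.mem_union, Set.mem_ofPred_eq, Finset.sum_apply] at hs ⊢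
  rcases le_abs.1 hs with h | h
  · left; linarith
  · right; linarith

/-- The number of cells is at most the inverse of their minimal mass. -/
theorem card_range_mul_le_one {E F : Type*} [MeasurableSpace E] {μ : Measure E}
    [IsProbabilityMeasure μ] (T : SimpleFunc E F) {m : ℝ}
    (hT : ∀ x, m ≤ μ.real (T ⁻¹' {T x})) : (T.range.card : ℝ) * m ≤ 1 := by
  have h : ∑ k ∈ T.range, μ.real (T ⁻¹' {k}) = 1 := by
    have h1 : ∑ k ∈ T.range, μ (T ⁻¹' {k}) = 1 := by
      rw [T.sum_range_measure_preimage_singleton, measure_univ]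
    simp_rw [measureReal_def]
    rw [← ENNReal.toReal_sum fun _ _ => measure_ne_top _ _, h1, ENNReal.toReal_one]
  rw [← h, ← nsmul_eq_mul]
  refine Finset.card_nsmul_le_sum _ _ _ fun k hk => ?_
  obtain ⟨x, rfl⟩ := SimpleFunc.mem_range.1 hk
  exact hT x

/-- The ratio of the empirical frequency of the cell of `y` to its mass. -/
noncomputable def cellRatio {E F : Type*} [MeasurableSpace E] (μ : Measure E) (T : SimpleFunc E F)
    (x : ℕ → E) (n : ℕ) (y : E) : ℝ :=
  (∑ i ∈ Finset.range n, (T ⁻¹' {T y}).indicator (fun _ => (1 : ℝ)) (x i)) /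
    (n * μ.real (T ⁻¹' {T y}))

/-- If the minimal mass `m n` of the cells satisfies `n * m n ≫ log n`, then almost surely all
cell frequencies are asymptotic to the cell masses, uniformly in the cell: for each tolerance the
probabilities of the exceptional events are at most `2 / n ^ 2` for large `n`. -/
theorem ae_tendstoUniformly_cellRatio {S E F : Type*} [MeasurableSpace S] [MeasurableSpace E]
    {P : Measure S} [IsProbabilityMeasure P] {μ : Measure E} [IsProbabilityMeasure μ]
    {X : ℕ → S → E} (hX : ∀ i, Measurable (X i))
    (hindep : ProbabilityTheory.iIndepFun X P) (hlaw : ∀ i, P.map (X i) = μ)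
    {T : ℕ → SimpleFunc E F} {m : ℕ → ℝ} (hm : ∀ n, 0 < m n)
    (hT : ∀ n x, m n ≤ μ.real (T n ⁻¹' {T n x}))
    (hlog : ∀ M : ℝ, ∀ᶠ n : ℕ in atTop, M * Real.log n ≤ n * m n) :
    ∀ᵐ s ∂P, TendstoUniformly (fun n => cellRatio μ (T n) (fun i => X i s) n) (fun _ => 1)
      atTop := by
  set B : ℝ → ℕ → Set S := fun δ n => ⋃ k ∈ (T n).range, {s | δ * (n * μ.real (T n ⁻¹' {k})) ≤
      |∑ i ∈ Finset.range n, (T n ⁻¹' {k}).indicator (fun _ => (1 : ℝ)) (X i s) -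
        n * μ.real (T n ⁻¹' {k})|} with hB
  have hBsum : ∀ δ, 0 < δ → δ ≤ 1 → ∑' n, P (B δ n) ≠ ∞ := by
    intro δ hδ hδ1
    have hbound : ∀ᶠ n : ℕ in atTop, ‖P.real (B δ n)‖ ≤ 2 * (1 / (n : ℝ) ^ 2) := by
      filter_upwards [hlog (12 / δ ^ 2), hlog 1, eventually_ge_atTop 3] with n hn hn1 hn3
      have hn0 : (0 : ℝ) < n := by positivity
      have hlog1 : 1 ≤ Real.log n := by
        rw [Real.le_log_iff_exp_le hn0]
        have : (3 : ℝ) ≤ n := by exact_mod_cast hn3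
        linarith [Real.exp_one_lt_d9]
      have hcard : ((T n).range.card : ℝ) ≤ n := by
        have h1 := card_range_mul_le_one (T n) (hT n)
        by_contra! h
        nlinarith [mul_lt_mul_of_pos_right h (hm n)]
      have hexp : Real.exp (-(n * m n * δ ^ 2 / 4)) ≤ 1 / (n : ℝ) ^ 3 := by
        have h3 : Real.log ((n : ℝ) ^ 3) ≤ n * m n * δ ^ 2 / 4 := by
          rw [div_mul_eq_mul_div, div_le_iff₀ (by positivity)] at hn
          rw [Real.log_pow]
          push_cast
          linarith
        rw [one_div, ← Real.exp_log (show (0 : ℝ) < (n : ℝ) ^ 3 by positivity), ← Real.exp_neg,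
          Real.exp_le_exp]
        linarith
      rw [Real.norm_of_nonneg measureReal_nonneg]
      calc P.real (B δ n)
          ≤ ∑ k ∈ (T n).range, 2 * Real.exp (-(n * μ.real (T n ⁻¹' {k}) * δ ^ 2 / 4)) :=
            (measureReal_biUnion_finset_le _ _).trans (Finset.sum_le_sum fun k _ =>
              measureReal_abs_sum_indicator_sub_ge_le hX hindep hlaw
                ((T n).measurableSet_fiber k) hδ hδ1 n)
        _ ≤ ∑ k ∈ (T n).range, 2 * (1 / (n : ℝ) ^ 3) := by
            refine Finset.sum_le_sum fun k hk => ?_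
            obtain ⟨x, rfl⟩ := SimpleFunc.mem_range.1 hk
            refine mul_le_mul_of_nonneg_left (le_trans (Real.exp_le_exp.2 ?_) hexp) zero_le_two
            have := hT n x
            gcongr
        _ ≤ n * (2 * (1 / (n : ℝ) ^ 3)) := by
            rw [Finset.sum_const, nsmul_eq_mul]
            gcongr
        _ = 2 * (1 / (n : ℝ) ^ 2) := by field_simp
    have hsum : Summable fun n => P.real (B δ n) :=
      Summable.of_norm_bounded_eventually_nat
        ((Real.summable_one_div_nat_pow.2 one_lt_two).mul_left 2) hbound
    have := hsum.tsum_ofReal_ne_top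
    simpa only [ofReal_measureReal (measure_ne_top P _)] using this
  have hae : ∀ᵐ s ∂P, ∀ j : ℕ, ∀ᶠ n in atTop, s ∉ B (1 / (j + 1)) n :=
    ae_all_iff.2 fun j => ae_eventually_notMem (hBsum _ (by positivity)
      (by rw [div_le_one (by positivity)]; linarith [(Nat.cast_nonneg j : (0 : ℝ) ≤ j)]))
  filter_upwards [hae] with s hs
  rw [Metric.tendstoUniformly_iff]
  intro δ hδ
  obtain ⟨j, hj⟩ := exists_nat_one_div_lt hδ
  filter_upwards [hs j, eventually_gt_atTop 0] with n hn hn0 y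
  have hpos : 0 < n * μ.real (T n ⁻¹' {T n y}) :=
    mul_pos (by exact_mod_cast hn0) ((hm n).trans_le (hT n y))
  have hlt : |∑ i ∈ Finset.range n, (T n ⁻¹' {T n y}).indicator (fun _ => (1 : ℝ)) (X i s) -
      n * μ.real (T n ⁻¹' {T n y})| < 1 / (j + 1) * (n * μ.real (T n ⁻¹' {T n y})) := by
    by_contra! h
    exact hn (Set.mem_biUnion (SimpleFunc.mem_range_self (T n) y) h)
  rw [dist_comm, Real.dist_eq, cellRatio, div_sub_one hpos.ne', abs_div, abs_of_pos hpos,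
    div_lt_iff₀ hpos]
  exact hlt.trans (mul_lt_mul_of_pos_right hj hpos)

/-! ### Redistribution of point masses over cells -/

/-- Averaging the plans that move each sample point onto its own law `ν i`. -/
theorem transportDistInfty_empiricalMeasure_le {E : Type*} [MeasurableSpace E]
    [PseudoEMetricSpace E] [OpensMeasurableSpace (E × E)] {x : ℕ → E} {n : ℕ}
    {ν : ℕ → Measure E} [∀ i, IsProbabilityMeasure (ν i)] {D : ℝ≥0∞}
    (h : ∀ i < n, ∀ᵐ y ∂ν i, edist (x i) y ≤ D) :
    transportDistInfty (empiricalMeasure x n)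
      ((n : ℝ≥0∞)⁻¹ • ∑ i ∈ Finset.range n, ν i) ≤ D := by
  set γ : Measure (E × E) :=
    (n : ℝ≥0∞)⁻¹ • ∑ i ∈ Finset.range n, (ν i).map (Prod.mk (x i)) with hγ
  have hmap : ∀ f : E × E → E, Measurable f →
      γ.map f = (n : ℝ≥0∞)⁻¹ • ∑ i ∈ Finset.range n, (ν i).map (fun y => f (x i, y)) := by
    intro f hf
    have : ∀ i, (ν i).map (fun y => f (x i, y)) = ((ν i).map (Prod.mk (x i))).map f := fun i =>
      (Measure.map_map hf measurable_prodMk_left).symm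
    simp_rw [this, hγ, Measure.map_smul, ← Measure.mapₗ_apply_of_measurable hf, map_sum]
  have hmem : γ ∈ transportPlans (empiricalMeasure x n)
      ((n : ℝ≥0∞)⁻¹ • ∑ i ∈ Finset.range n, ν i) := by
    refine ⟨?_, ?_⟩
    · rw [hmap _ measurable_fst]
      simp [empiricalMeasure]
    · rw [hmap _ measurable_snd]
      simp
  refine (iInf₂_le γ hmem).trans (essSup_le_of_ae_le _ ?_)
  refine Measure.ae_smul_measure ?_ _
  change ∀ᵐ p : E × E ∂(∑ i ∈ Finset.range n, (ν i).map (Prod.mk (x i))), edist p.1 p.2 ≤ D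
  rw [ae_iff, Measure.coe_finsetSum, Finset.sum_apply, Finset.sum_eq_zero]
  intro i hi
  rw [← ae_iff, ae_map_iff measurable_prodMk_left.aemeasurable
    (measurableSet_le continuous_edist.measurable measurable_const)]
  exact h i (Finset.mem_range.1 hi)

/-- The measure obtained from the empirical measure by spreading each point mass over the cell
containing it, proportionally to `μ`; for `n = 0` it is set to `μ`. -/
noncomputable def smearedMeasure {E F : Type*} [MeasurableSpace E] (μ : Measure E)
    (T : SimpleFunc E F) (x : ℕ → E) (n : ℕ) : Measure E :=
  if n = 0 then μ else
    (n : ℝ≥0∞)⁻¹ • ∑ i ∈ Finset.range n, ProbabilityTheory.cond μ (T ⁻¹' {T (x i)})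

theorem measurable_smearedMeasure {S E F : Type*} [MeasurableSpace S] [MeasurableSpace E]
    (μ : Measure E) (T : SimpleFunc E F) {X : ℕ → S → E} (hX : ∀ i, Measurable (X i)) (n : ℕ) :
    Measurable fun s => smearedMeasure μ T (fun i => X i s) n := by
  unfold smearedMeasure
  split_ifs
  · exact measurable_const
  have h : ∀ i, Measurable fun s => ProbabilityTheory.cond μ (T ⁻¹' {T (X i s)}) := fun i =>
    (T.map fun k => ProbabilityTheory.cond μ (T ⁻¹' {k})).measurable.comp (hX i)
  refine Measure.measurable_of_measurable_coe _ fun A hA => ?_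
  simp only [Measure.smul_apply, Measure.coe_finsetSum, Finset.sum_apply, smul_eq_mul]
  exact (Finset.measurable_sum _ fun i _ =>
    (Measure.measurable_coe hA).comp (h i)).const_mul _

theorem isProbabilityMeasure_smearedMeasure {E F : Type*} [MeasurableSpace E] {μ : Measure E}
    [IsProbabilityMeasure μ] {T : SimpleFunc E F} (hT : ∀ x, μ (T ⁻¹' {T x}) ≠ 0) (x : ℕ → E)
    (n : ℕ) : IsProbabilityMeasure (smearedMeasure μ T x n) := by
  unfold smearedMeasure
  split_ifs with hn
  · infer_instance
  have (i : ℕ) : IsProbabilityMeasure (ProbabilityTheory.cond μ (T ⁻¹' {T (x i)})) :=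
    ProbabilityTheory.cond_isProbabilityMeasure (hT _)
  refine ⟨?_⟩
  simp only [Measure.smul_apply, Measure.coe_finsetSum, Finset.sum_apply, measure_univ,
    Finset.sum_const, Finset.card_range, nsmul_eq_mul, mul_one, smul_eq_mul]
  exact ENNReal.inv_mul_cancel (by exact_mod_cast hn) (ENNReal.natCast_ne_top n)

theorem transportDistInfty_smearedMeasure_le {E F : Type*} [MeasurableSpace E]
    [PseudoMetricSpace E] [OpensMeasurableSpace (E × E)] {μ : Measure E} [IsProbabilityMeasure μ]
    {T : SimpleFunc E F} {Ω : Set E} (hΩ : ∀ᵐ y ∂μ, y ∈ Ω) {D : ℝ}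
    (hdiam : ∀ x ∈ Ω, ∀ y ∈ Ω, T x = T y → dist x y ≤ D)
    (hT : ∀ x, μ (T ⁻¹' {T x}) ≠ 0) {x : ℕ → E} (hx : ∀ i, x i ∈ Ω) {n : ℕ} (hn : n ≠ 0) :
    transportDistInfty (empiricalMeasure x n) (smearedMeasure μ T x n) ≤ ENNReal.ofReal D := by
  rw [smearedMeasure, if_neg hn]
  have (i : ℕ) : IsProbabilityMeasure (ProbabilityTheory.cond μ (T ⁻¹' {T (x i)})) :=
    ProbabilityTheory.cond_isProbabilityMeasure (hT _)
  refine transportDistInfty_empiricalMeasure_le fun i _ => ?_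
  filter_upwards [ProbabilityTheory.cond_absolutelyContinuous.ae_le hΩ,
    ProbabilityTheory.ae_cond_mem (T.measurableSet_fiber (T (x i)))] with y hy hyT
  rw [edist_dist]
  exact ENNReal.ofReal_le_ofReal (hdiam _ (hx i) _ hy hyT.symm)

/-- The density of the smeared measure with respect to `μ` is the cell ratio. -/
theorem exists_smearedMeasure_eq_withDensity {E F : Type*} [MeasurableSpace E] {μ : Measure E}
    [IsProbabilityMeasure μ] {T : SimpleFunc E F} (hT : ∀ x, μ (T ⁻¹' {T x}) ≠ 0) (x : ℕ → E)
    {n : ℕ} (hn : n ≠ 0) :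
    ∃ g : E → ℝ≥0∞, Measurable g ∧ smearedMeasure μ T x n = μ.withDensity g ∧
      ∀ y, (g y).toReal = cellRatio μ T x n y := by
  have hmeas : ∀ i, Measurable ((T ⁻¹' {T (x i)}).indicator fun _ => (μ (T ⁻¹' {T (x i)}))⁻¹) :=
    fun i => measurable_const.indicator (T.measurableSet_fiber _)
  refine ⟨fun y => (n : ℝ≥0∞)⁻¹ * ∑ i ∈ Finset.range n,
    (T ⁻¹' {T (x i)}).indicator (fun _ => (μ (T ⁻¹' {T (x i)}))⁻¹) y,
    (Finset.measurable_sum _ fun i _ => hmeas i).const_mul _, ?_, fun y => ?_⟩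
  · ext A hA
    rw [smearedMeasure, if_neg hn, withDensity_apply _ hA,
      lintegral_const_mul _ (Finset.measurable_sum _ fun i _ => hmeas i),
      lintegral_finsetSum _ fun i _ => hmeas i]
    simp only [Measure.smul_apply, Measure.coe_finsetSum, Finset.sum_apply, smul_eq_mul]
    congr 1
    refine Finset.sum_congr rfl fun i _ => ?_
    rw [ProbabilityTheory.cond_apply (T.measurableSet_fiber _),
      lintegral_indicator (T.measurableSet_fiber _), setLIntegral_const,
      Measure.restrict_apply (T.measurableSet_fiber _)]
  · have hterm : ∀ i, (T ⁻¹' {T (x i)}).indicator (fun _ => (μ (T ⁻¹' {T (x i)}))⁻¹) y =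
        (T ⁻¹' {T y}).indicator (fun _ => (μ (T ⁻¹' {T y}))⁻¹) (x i) := fun i => by
      by_cases h : T y = T (x i)
      · simp [h]
      · simp [h, Ne.symm h]
    have hreal : ∀ i, ((T ⁻¹' {T y}).indicator (fun _ => (μ (T ⁻¹' {T y}))⁻¹) (x i)).toReal =
        (T ⁻¹' {T y}).indicator (fun _ => (1 : ℝ)) (x i) * (μ.real (T ⁻¹' {T y}))⁻¹ := fun i => by
      by_cases h : T (x i) = T y <;> simp [h, measureReal_def]
    simp_rw [hterm]
    rw [ENNReal.toReal_mul, ENNReal.toReal_sum]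
    · simp_rw [hreal]
      rw [← Finset.sum_mul, cellRatio, ENNReal.toReal_inv, ENNReal.toReal_natCast]
      ring
    · intro i _
      by_cases h : T (x i) = T y <;> simp [h, hT]

/-! ### The choice of scale and the conclusion -/

/-- There are scales `ℓ n` with `(log n / n) ^ (1 / d) ≪ ℓ n ≪ ε n`. -/
theorem exists_intermediate_scale {d : ℕ} (hd : d ≠ 0) {ε : ℕ → ℝ} (hε : ∀ n, 0 < ε n)
    (hε0 : Tendsto ε atTop (𝓝 0))
    (hscale : Tendsto
      (fun n : ℕ => (Real.log n) ^ (1 / (d : ℝ)) / (ε n * (n : ℝ) ^ (1 / (d : ℝ)))) atTop (𝓝 0))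
    {r₀ : ℝ} (hr₀ : 0 < r₀) :
    ∃ ℓ : ℕ → ℝ, (∀ n, 0 < ℓ n) ∧ (∀ n, ℓ n ≤ r₀) ∧
      Tendsto (fun n => ℓ n / ε n) atTop (𝓝 0) ∧
      ∀ M : ℝ, ∀ᶠ n : ℕ in atTop, M * Real.log n ≤ n * ℓ n ^ d := by
  set r : ℕ → ℝ := fun n => (Real.log n) ^ (1 / (d : ℝ)) / (ε n * (n : ℝ) ^ (1 / (d : ℝ))) with hr
  have hr_nonneg : ∀ n, 0 ≤ r n := fun n =>
    div_nonneg (Real.rpow_nonneg (Real.log_natCast_nonneg n) _)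
      (mul_nonneg (hε n).le (Real.rpow_nonneg (Nat.cast_nonneg n) _))
  -- The geometric mean `ε n * √(r n)` of the two scales would do; `1 / (n + 1)` keeps it positive.
  set u : ℕ → ℝ := fun n => √(r n + 1 / ((n : ℝ) + 1)) with hu
  have hu_pos : ∀ n, 0 < u n := fun n =>
    Real.sqrt_pos.2 (add_pos_of_nonneg_of_pos (hr_nonneg n) (by positivity))
  have hu0 : Tendsto u atTop (𝓝 0) := by
    have := (hscale.add tendsto_one_div_add_atTop_nhds_zero_nat).sqrt
    rwa [add_zero, Real.sqrt_zero] at this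
  have hru : ∀ n, r n ≤ u n ^ 2 := fun n => by
    rw [hu, Real.sq_sqrt (add_nonneg (hr_nonneg n) (by positivity))]
    exact le_add_of_nonneg_right (by positivity)
  have hεu : Tendsto (fun n => ε n * u n) atTop (𝓝 0) := by simpa using hε0.mul hu0
  refine ⟨fun n => min r₀ (ε n * u n), fun n => lt_min hr₀ (mul_pos (hε n) (hu_pos n)),
    fun n => min_le_left _ _, ?_, fun M => ?_⟩
  · refine squeeze_zero (fun n => div_nonneg
      (le_min hr₀.le (mul_pos (hε n) (hu_pos n)).le) (hε n).le) (fun n => ?_) hu0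
    rw [div_le_iff₀ (hε n), mul_comm]
    exact min_le_right _ _
  · have hMu : Tendsto (fun n => M * u n ^ d) atTop (𝓝 0) := by
      simpa [hd] using (hu0.pow d).const_mul M
    filter_upwards [hεu.eventually_le_const hr₀, hMu.eventually_le_const one_pos,
      eventually_gt_atTop 0] with n hn hM hn0
    rw [min_eq_right hn]
    have hn0' : (0 : ℝ) < n := by exact_mod_cast hn0
    have hd' : (d : ℝ) ≠ 0 := by exact_mod_cast hd
    have hlog : Real.log n = n * (ε n * r n) ^ d := by
      have h1 : ε n * r n = (Real.log n / n) ^ (1 / (d : ℝ)) := by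
        rw [Real.div_rpow (Real.log_natCast_nonneg n) hn0'.le, hr]
        have := (hε n).ne'
        have := (Real.rpow_pos_of_pos hn0' (1 / (d : ℝ))).ne'
        field_simp
      rw [h1, one_div, Real.rpow_inv_natCast_pow
        (div_nonneg (Real.log_natCast_nonneg n) hn0'.le) hd]
      field_simp
    rcases le_or_gt M 0 with hM0 | hM0
    · exact (mul_nonpos_of_nonpos_of_nonneg hM0 (Real.log_natCast_nonneg n)).trans
        (mul_nonneg hn0'.le (pow_nonneg (mul_pos (hε n) (hu_pos n)).le d))
    calc M * Real.log n = M * (n * (ε n * r n) ^ d) := by rw [← hlog]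
      _ ≤ M * (n * (ε n * u n ^ 2) ^ d) := by
          have := hr_nonneg n
          have := (hε n).le
          gcongr
          exact hru n
      _ = (M * u n ^ d) * (n * (ε n * u n) ^ d) := by
          rw [mul_pow, mul_pow, ← pow_mul, mul_comm 2 d, pow_mul]; ring
      _ ≤ 1 * (n * (ε n * u n) ^ d) := by
          have := (mul_pos (hε n) (hu_pos n)).le
          gcongr
      _ = n * (ε n * u n) ^ d := one_mul _

theorem mainTheorem5 {d : ℕ} (hd : 2 ≤ d)
    (Ω : Set (EuclideanSpace ℝ (Fin d)))
    (hΩ_open : IsOpen Ω) (hΩ_bdd : Bornology.IsBounded Ω) (hΩ_lip : HasLipschitzBoundary Ω)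
    (ρ : EuclideanSpace ℝ (Fin d) → ℝ) (hρ_cont : ContinuousOn ρ (closure Ω))
    (hρ_bdd : ∃ c C : ℝ, 0 < c ∧ ∀ x ∈ closure Ω, c ≤ ρ x ∧ ρ x ≤ C)
    (μ : Measure (EuclideanSpace ℝ (Fin d))) [IsProbabilityMeasure μ]
    (hμ : μ = (volume.restrict Ω).withDensity (fun x => ENNReal.ofReal (ρ x)))
    (ε : ℕ → ℝ) (hε_pos : ∀ n, 0 < ε n) (hε_zero : Tendsto ε atTop (𝓝 0))
    (hε_scale : Tendsto
      (fun n : ℕ => (Real.log n) ^ (1 / (d : ℝ)) / (ε n * (n : ℝ) ^ (1 / (d : ℝ)))) atTop (𝓝 0))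
    {S : Type*} [MeasurableSpace S] (P : Measure S) [IsProbabilityMeasure P]
    (X : ℕ → S → EuclideanSpace ℝ (Fin d)) (hX_meas : ∀ i, Measurable (X i))
    (hX_indep : ProbabilityTheory.iIndepFun X P) (hX_law : ∀ i, P.map (X i) = μ) :
    ∃ μt : ℕ → S → Measure (EuclideanSpace ℝ (Fin d)),
      (∀ n, Measurable (μt n)) ∧
      (∀ n s, IsProbabilityMeasure (μt n s)) ∧
      (∀ n s, μt n s ≪ μ) ∧
      (∀ᵐ s ∂P, Tendsto
        (fun n => transportDistInfty (empiricalMeasure (fun i => X i s) n) (μt n s) /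
          ENNReal.ofReal (ε n)) atTop (𝓝 0)) ∧
      (∀ᵐ s ∂P, ∃ f : ℕ → EuclideanSpace ℝ (Fin d) → ℝ,
        (∀ n, Measurable (f n)) ∧
        (∀ n, f n =ᵐ[μ] fun x => ((μt n s).rnDeriv μ x).toReal) ∧
        TendstoUniformlyOn f (fun _ => 1) atTop (closure Ω)) := by
  have hΩ : ∀ᵐ y ∂μ, y ∈ Ω := by
    rw [hμ]
    exact (withDensity_absolutelyContinuous _ _).ae_le (ae_restrict_mem hΩ_open.measurableSet)
  obtain ⟨c, C, hc, hρ⟩ := hρ_bdd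
  obtain ⟨κ, r₀, hκ, hr₀, hpart⟩ :=
    (hΩ_lip.hasInteriorBalls hΩ_open hΩ_bdd).exists_partition hΩ_bdd hΩ.exists hc
      (fun x hx => (hρ x (subset_closure hx)).1) hμ
  obtain ⟨ℓ, hℓ_pos, hℓ_le, hℓε, hℓ_log⟩ :=
    exists_intermediate_scale (by lia : d ≠ 0) hε_pos hε_zero hε_scale hr₀
  choose T hTdiam hTmass using fun n => hpart (ℓ n) (hℓ_pos n) (hℓ_le n)
  have hm : ∀ n, 0 < κ * ℓ n ^ d := fun n => mul_pos hκ (pow_pos (hℓ_pos n) d)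
  have hT0 : ∀ n x, μ (T n ⁻¹' {T n x}) ≠ 0 := fun n x h => by
    have := (hm n).trans_le (hTmass n x)
    simp [measureReal_def, h] at this
  have hprob : ∀ n s, IsProbabilityMeasure (smearedMeasure μ (T n) (fun i => X i s) n) :=
    fun n s => isProbabilityMeasure_smearedMeasure (hT0 n) _ n
  refine ⟨fun n s => smearedMeasure μ (T n) (fun i => X i s) n,
    fun n => measurable_smearedMeasure μ (T n) hX_meas n, hprob, fun n s => ?_, ?_, ?_⟩
  · dsimp only
    rcases eq_or_ne n 0 with rfl | hn
    · simp [smearedMeasure, Measure.AbsolutelyContinuous.rfl]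
    · obtain ⟨g, -, hg, -⟩ := exists_smearedMeasure_eq_withDensity (hT0 n) (fun i => X i s) hn
      rw [hg]
      exact withDensity_absolutelyContinuous _ _
  · have hXΩ : ∀ᵐ s ∂P, ∀ i, X i s ∈ Ω := ae_all_iff.2 fun i => by
      rw [← hX_law i] at hΩ
      exact ae_of_ae_map (hX_meas i).aemeasurable hΩ
    filter_upwards [hXΩ] with s hs
    have hlim : Tendsto (fun n => ENNReal.ofReal (2 * (ℓ n / ε n))) atTop (𝓝 0) := by
      simpa using ENNReal.tendsto_ofReal (hℓε.const_mul 2)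
    refine tendsto_of_tendsto_of_tendsto_of_le_of_le' tendsto_const_nhds hlim
      (Eventually.of_forall fun n => zero_le) ?_
    filter_upwards [eventually_ne_atTop 0] with n hn
    rw [← mul_div_assoc, ENNReal.ofReal_div_of_pos (hε_pos n)]
    gcongr
    exact transportDistInfty_smearedMeasure_le hΩ (hTdiam n) (hT0 n) hs hn
  · have hlog : ∀ M : ℝ, ∀ᶠ n : ℕ in atTop, M * Real.log n ≤ n * (κ * ℓ n ^ d) := fun M => by
      filter_upwards [hℓ_log (M / κ)] with n hn
      rw [div_mul_eq_mul_div, div_le_iff₀ hκ] at hn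
      linarith
    filter_upwards [ae_tendstoUniformly_cellRatio hX_meas hX_indep hX_law hm hTmass hlog]
      with s hs
    have hg : ∀ n, ∃ f : EuclideanSpace ℝ (Fin d) → ℝ, Measurable f ∧
        (f =ᵐ[μ] fun x =>
          ((smearedMeasure μ (T n) (fun i => X i s) n).rnDeriv μ x).toReal) ∧
        (n ≠ 0 → f = cellRatio μ (T n) (fun i => X i s) n) := fun n => by
      rcases eq_or_ne n 0 with rfl | hn
      · exact ⟨_, (Measure.measurable_rnDeriv _ μ).ennreal_toReal, EventuallyEq.rfl,
          fun h => absurd rfl h⟩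
      · obtain ⟨g, hgm, hg, hgr⟩ :=
          exists_smearedMeasure_eq_withDensity (hT0 n) (fun i => X i s) hn
        refine ⟨fun y => (g y).toReal, hgm.ennreal_toReal, ?_, fun _ => funext hgr⟩
        rw [hg]
        filter_upwards [Measure.rnDeriv_withDensity μ hgm] with y hy
        rw [hy]
    choose f hfm hfae hf using hg
    refine ⟨f, hfm, hfae, ?_⟩
    refine hs.tendstoUniformlyOn.congr ?_
    filter_upwards [eventually_ne_atTop 0] with n hn y _
    rw [hf n hn]
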